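/- Let $H_1$ and $H_2$ be finite-dimensional complex Hilbert spaces, let $d_2=\dim H_2$, and let $1\le p\le 2$. For an operator $\rho$ on $H_1\otimes H_2$ let $\rho_1=\mathrm{Tr}_2\,\rho$ denote its partial trace on $H_1$, that is, the image of $\rho$ under the linear map determined by $(A\otimes B)_1=\mathrm{Tr}(B)\,A$ for operators $A$ on $H_1$ and $B$ on $H_2$. Let $\mathrm{Tr}_{12}$ and $\mathrm{Tr}_1$ denote the traces of operators on $H_1\otimes H_2$ and on $H_1$. Then the map $$ G(\rho)=d_2^{\,p-1}\,\mathrm{Tr}_{12}\,\rho^p-\mathrm{Tr}_1\,\rho_1^p $$ is convex on the set of positive definite operators $\rho$ on $H_1\otimes H_2$. -/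

import Mathlib

open scoped TensorProduct InnerProductSpace

noncomputable section

/-- A tensor product of finite-dimensional Hilbert spaces is complete, hence a Hilbert space. -/
instance tensorCompleteSpace {H₁ H₂ : Type*}
    [NormedAddCommGroup H₁] [InnerProductSpace ℂ H₁] [FiniteDimensional ℂ H₁]
    [NormedAddCommGroup H₂] [InnerProductSpace ℂ H₂] [FiniteDimensional ℂ H₂] :
    CompleteSpace (H₁ ⊗[ℂ] H₂) :=
  FiniteDimensional.complete ℂ (H₁ ⊗[ℂ] H₂)

/-- The trace of an operator on a finite-dimensional Hilbert space. -/
def opTrace {H : Type*} [NormedAddCommGroup H] [InnerProductSpace ℂ H] (A : H →L[ℂ] H) : ℂ :=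
  LinearMap.trace ℂ H A

/-- The real power `A ^ p`, given by the continuous functional calculus in `B(H)`. -/
def opPower {H : Type*} [NormedAddCommGroup H] [InnerProductSpace ℂ H] [CompleteSpace H]
    (A : H →L[ℂ] H) (p : ℝ) : H →L[ℂ] H :=
  A ^ p

/-- The partial trace `Tr₂ : B(H₁ ⊗ H₂) → B(H₁)`, i.e. the linear map determined by
`A ⊗ B ↦ Tr(B) • A` under the identification `B(H₁) ⊗ B(H₂) = B(H₁ ⊗ H₂)`. -/
def partialTrace₂ {H₁ H₂ : Type*}
    [NormedAddCommGroup H₁] [InnerProductSpace ℂ H₁] [FiniteDimensional ℂ H₁]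
    [NormedAddCommGroup H₂] [InnerProductSpace ℂ H₂] [FiniteDimensional ℂ H₂]
    (ρ : (H₁ ⊗[ℂ] H₂) →L[ℂ] (H₁ ⊗[ℂ] H₂)) : H₁ →L[ℂ] H₁ :=
  LinearMap.toContinuousLinearMap
    (TensorProduct.rid ℂ (H₁ →ₗ[ℂ] H₁)
      (TensorProduct.map LinearMap.id (LinearMap.trace ℂ H₂)
        ((homTensorHomEquiv ℂ H₁ H₂ H₁ H₂).symm (ρ : (H₁ ⊗[ℂ] H₂) →ₗ[ℂ] (H₁ ⊗[ℂ] H₂)))))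

/-- Positive definiteness of an operator: self-adjoint, with `⟪A x, x⟫ > 0` for all `x ≠ 0`. -/
def IsPosDefOp {H : Type*} [NormedAddCommGroup H] [InnerProductSpace ℂ H] [CompleteSpace H]
    (A : H →L[ℂ] H) : Prop :=
  IsSelfAdjoint A ∧ ∀ x : H, x ≠ 0 → 0 < (⟪A x, x⟫_ℂ).re

end

noncomputable section

/-! Write d = dim H₂ and let D(B|A) be the Bregman divergence of X ↦ Tr X^p. Convexity follows from
a supporting affine function at every A (`ConvexOn.of_exists_support`). Taking the first-order
expansion of G at A, the support inequality becomes D(B₁|A₁) ≤ d^(p-1) D(B|A), which is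
`sum_bregman_partialTrace₂_le`.

With L_B and R_A denoting left and right multiplication, Taylor's formula in eigenbases of B and A
writes D(B|A) as an integral over s, with nonnegative weight, of the quadratic form of (s L_B +
(1-s) R_A)^(p-2) at B - A. For 1 < p < 2 the power u^(p-2) is a positive mixture of resolvents (t +
u)⁻¹, so comparing resolvents is enough (`sum_rpow_le_of_sum_inv_le`).

The resolvent form is the maximum over Z of `resolventForm`. Testing with Z ⊗ 1 gives the same
functional of the partial traces with t replaced by d t (`resolventForm_rTensor`), whence
`sum_inv_partialTrace₂_le`. Rescaling t in the mixture turns d t into the factor d^(p-1). -/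

/-! ### Scalar integral representations of powers -/

theorem add_mul_one_sub_pos {x y s : ℝ} (hx : 0 < x) (hy : 0 < y) (hs : s ∈ Set.Icc (0 : ℝ) 1) :
    0 < s * x + (1 - s) * y := by
  rcases hs.1.eq_or_lt with h | h
  · simpa [← h] using hy
  · have := mul_pos h hx
    have := mul_nonneg (sub_nonneg.2 hs.2) hy.le
    linarith

/-- Taylor's formula with integral remainder for `x ↦ x ^ p`. -/
theorem integral_taylor_rpow {x y : ℝ} (hx : 0 < x) (hy : 0 < y) (p : ℝ) :
    ∫ s in (0 : ℝ)..1, p * (p - 1) * ((1 - s) * ((s * x + (1 - s) * y) ^ (p - 2) * (x - y) ^ 2))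
      = x ^ p - y ^ p - p * y ^ (p - 1) * (x - y) := by
  have hpos : ∀ s ∈ Set.uIcc (0 : ℝ) 1, 0 < s * x + (1 - s) * y := by
    rw [Set.uIcc_of_le zero_le_one]
    exact fun s hs => add_mul_one_sub_pos hx hy hs
  -- The antiderivative (1-s) f'(·)(x-y) + f(·) comes from integration by parts, with f = (·)^p on
  -- the segment.
  have key : ∀ s ∈ Set.uIcc (0 : ℝ) 1, HasDerivAt
      (fun s : ℝ => (1 - s) * (p * (s * x + (1 - s) * y) ^ (p - 1) * (x - y))
        + (s * x + (1 - s) * y) ^ p)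
      (p * (p - 1) * ((1 - s) * ((s * x + (1 - s) * y) ^ (p - 2) * (x - y) ^ 2))) s := by
    intro s hs
    have hne := (hpos s hs).ne'
    have h0 : HasDerivAt (fun s : ℝ => 1 - s) (-1) s := by
      simpa using (hasDerivAt_id s).const_sub 1
    have h1 : HasDerivAt (fun s : ℝ => s * x + (1 - s) * y) (x - y) s := by
      exact (((hasDerivAt_id s).mul_const x).add (h0.mul_const y)).congr_deriv (by ring)
    have h2 := h1.rpow_const (p := p - 1) (Or.inl hne)
    have h3 := h1.rpow_const (p := p) (Or.inl hne)
    refine ((h0.mul ((h2.const_mul p).mul_const (x - y))).add h3).congr_deriv ?_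
    rw [show p - 1 - 1 = p - 2 by ring]
    ring
  rw [intervalIntegral.integral_eq_sub_of_hasDerivAt key]
  · simp
    ring
  · apply ContinuousOn.intervalIntegrable
    refine continuousOn_const.mul ((by fun_prop : ContinuousOn (fun s : ℝ => 1 - s) _).mul ?_)
    refine ContinuousOn.mul (ContinuousOn.rpow_const (by fun_prop) ?_) continuousOn_const
    exact fun s hs => Or.inl (hpos s hs).ne'

/-- The power `u ^ (q - 1)` as a Stieltjes integral. -/
theorem exists_rpow_sub_one_eq_integral {q : ℝ} (hq : q ∈ Set.Ioo (0 : ℝ) 1) :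
    ∃ C : ℝ, 0 ≤ C ∧ ∀ u : ℝ, 0 < u →
      MeasureTheory.IntegrableOn (fun t : ℝ => t ^ (q - 1) * (t + u)⁻¹) (Set.Ioi 0) ∧
      u ^ (q - 1) = C * ∫ t in Set.Ioi (0 : ℝ), t ^ (q - 1) * (t + u)⁻¹ := by
  -- C normalises the integral formula for u^q; dividing that formula by u gives the one for
  -- u^(q-1).
  refine ⟨(∫ t in Set.Ioi 0, Real.rpowIntegrand₀₁ q t 1)⁻¹, ?_, fun u hu => ?_⟩
  · refine inv_nonneg.2 (MeasureTheory.setIntegral_nonneg measurableSet_Ioi fun t ht => ?_)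
    exact Real.rpowIntegrand₀₁_nonneg hq.1 (le_of_lt ht) zero_le_one
  · have heq : Set.EqOn (fun t => Real.rpowIntegrand₀₁ q t u * u⁻¹)
        (fun t : ℝ => t ^ (q - 1) * (t + u)⁻¹) (Set.Ioi 0) := by
      intro t ht
      have ht' : 0 < t := ht
      simp only [Real.rpowIntegrand₀₁_eq_pow_div hq ht'.le hu.le]
      field_simp
    constructor
    · exact MeasureTheory.IntegrableOn.congr_fun
        ((Real.integrableOn_rpowIntegrand₀₁_Ioi hq hu.le).mul_const _) heq measurableSet_Ioi
    · rw [← MeasureTheory.setIntegral_congr_fun measurableSet_Ioi heq,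
        MeasureTheory.integral_mul_const, ← mul_assoc,
        ← Real.rpow_eq_const_mul_integral hq hu.le, Real.rpow_sub_one hu.ne', div_eq_mul_inv]

/-- Domination of resolvents implies domination of the powers `u ^ (p - 2)`. -/
theorem sum_rpow_le_of_sum_inv_le {ι κ : Type*} [Fintype ι] [Fintype κ] {p d : ℝ}
    (hp₁ : 1 ≤ p) (hp₂ : p ≤ 2) (hd : 0 < d) {w u : ι → ℝ} {w' u' : κ → ℝ}
    (hu : ∀ i, 0 < u i) (hu' : ∀ k, 0 < u' k)
    (h : ∀ t : ℝ, 0 ≤ t → ∑ k, w' k * (d * t + u' k)⁻¹ ≤ ∑ i, w i * (t + u i)⁻¹)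
    (h₂ : ∑ k, w' k ≤ d * ∑ i, w i) :
    ∑ k, w' k * u' k ^ (p - 2) ≤ d ^ (p - 1) * ∑ i, w i * u i ^ (p - 2) := by
  -- The endpoints lie outside the Stieltjes formula: p = 1 is the resolvent bound at t = 0, and p =
  -- 2 is exactly `h₂`.
  rcases hp₁.eq_or_lt with rfl | hp₁
  · have := h 0 le_rfl
    norm_num [Real.rpow_neg_one] at this ⊢
    exact this
  rcases hp₂.eq_or_lt with rfl | hp₂
  · norm_num
    exact h₂
  have hq : p - 1 ∈ Set.Ioo (0 : ℝ) 1 := ⟨by linarith, by linarith⟩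
  obtain ⟨C, hC, hint⟩ := exists_rpow_sub_one_eq_integral hq
  have hpp : p - 1 - 1 = p - 2 := by ring
  have e2 : ∀ i, d ^ (p - 1) * (w i * u i ^ (p - 2))
      = C * ∫ t in Set.Ioi (0 : ℝ), w i * d * (t ^ (p - 1 - 1) * (t + d * u i)⁻¹) := by
    intro i
    rw [MeasureTheory.integral_const_mul, mul_left_comm C, ← (hint _ (mul_pos hd (hu i))).2,
      hpp, Real.mul_rpow hd.le (hu i).le, ← hpp, Real.rpow_sub_one hd.ne' (p - 1)]
    field_simp
  have e1 : ∀ k, w' k * u' k ^ (p - 2)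
      = C * ∫ t in Set.Ioi (0 : ℝ), w' k * (t ^ (p - 1 - 1) * (t + u' k)⁻¹) := by
    intro k
    rw [MeasureTheory.integral_const_mul, mul_left_comm C, ← (hint _ (hu' k)).2, hpp]
  rw [Finset.mul_sum, Finset.sum_congr rfl fun i _ => e2 i, Finset.sum_congr rfl fun k _ => e1 k,
    ← Finset.mul_sum, ← Finset.mul_sum,
    ← MeasureTheory.integral_finsetSum _ fun i _ =>
      ((hint _ (mul_pos hd (hu i))).1.const_mul _),
    ← MeasureTheory.integral_finsetSum _ fun k _ => ((hint _ (hu' k)).1.const_mul _)]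
  refine mul_le_mul_of_nonneg_left ?_ hC
  refine MeasureTheory.setIntegral_mono_on ?_ ?_ measurableSet_Ioi ?_
  · exact MeasureTheory.integrable_finsetSum _ fun k _ => ((hint _ (hu' k)).1.const_mul _)
  · exact MeasureTheory.integrable_finsetSum _ fun i _ =>
      ((hint _ (mul_pos hd (hu i))).1.const_mul _)
  · intro t ht
    have ht' : 0 < t := ht
    -- At t / d the left resolvent becomes (t + u')⁻¹ and the right one d (t + d u)⁻¹.
    have := mul_le_mul_of_nonneg_left (h (t / d) (by positivity))
      (Real.rpow_nonneg ht'.le (p - 1 - 1))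
    rw [Finset.mul_sum, Finset.mul_sum] at this
    convert this using 2 with k _ i _
    · rw [mul_div_cancel₀ _ hd.ne']
      ring
    · have := hu i
      field_simp

/-- The Bregman divergence sum of `x ↦ x ^ p` as an integral of sums of powers. -/
theorem sum_bregman_rpow {ι κ : Type*} [Fintype ι] [Fintype κ] (p : ℝ) {m : ι → κ → ℝ}
    {x : ι → ℝ} {y : κ → ℝ} (hx : ∀ i, 0 < x i) (hy : ∀ j, 0 < y j) :
    IntervalIntegrable (fun s => ∑ i, ∑ j,
      m i j * (p * (p - 1) * ((1 - s) * ((s * x i + (1 - s) * y j) ^ (p - 2) * (x i - y j) ^ 2))))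
      MeasureTheory.volume 0 1 ∧
    ∫ s in (0 : ℝ)..1, ∑ i, ∑ j,
      m i j * (p * (p - 1) * ((1 - s) * ((s * x i + (1 - s) * y j) ^ (p - 2) * (x i - y j) ^ 2)))
      = ∑ i, ∑ j, m i j * (x i ^ p - y j ^ p - p * y j ^ (p - 1) * (x i - y j)) := by
  have hI : ∀ i j, IntervalIntegrable (fun s : ℝ =>
      m i j * (p * (p - 1) * ((1 - s) * ((s * x i + (1 - s) * y j) ^ (p - 2) * (x i - y j) ^ 2))))
      MeasureTheory.volume 0 1 := by
    intro i j
    apply ContinuousOn.intervalIntegrable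
    refine continuousOn_const.mul (continuousOn_const.mul
      ((by fun_prop : ContinuousOn (fun s : ℝ => 1 - s) _).mul ?_))
    refine ContinuousOn.mul (ContinuousOn.rpow_const (by fun_prop) ?_) continuousOn_const
    rw [Set.uIcc_of_le zero_le_one]
    exact fun s hs => Or.inl (add_mul_one_sub_pos (hx i) (hy j) hs).ne'
  have hI' : ∀ i, IntervalIntegrable (fun s : ℝ => ∑ j,
      m i j * (p * (p - 1) * ((1 - s) * ((s * x i + (1 - s) * y j) ^ (p - 2) * (x i - y j) ^ 2))))
      MeasureTheory.volume 0 1 := fun i => by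
    simpa only [Finset.sum_fn] using IntervalIntegrable.sum Finset.univ fun j _ => hI i j
  refine ⟨by simpa only [Finset.sum_fn] using
    IntervalIntegrable.sum Finset.univ fun i _ => hI' i, ?_⟩
  rw [intervalIntegral.integral_finsetSum fun i _ => hI' i]
  refine Finset.sum_congr rfl fun i _ => ?_
  rw [intervalIntegral.integral_finsetSum fun j _ => hI i j]
  refine Finset.sum_congr rfl fun j _ => ?_
  rw [intervalIntegral.integral_const_mul, integral_taylor_rpow (hx i) (hy j)]

/-! ### Eigenbases, functional calculus and the Bregman divergence -/

section Spectral

variable {H : Type*} [NormedAddCommGroup H] [InnerProductSpace ℂ H] [FiniteDimensional ℂ H]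

theorem ContinuousLinearMap.finite_spectrum_real (A : H →L[ℂ] H) : (spectrum ℝ A).Finite := by
  have h : (spectrum ℂ A).Finite := by
    rw [← AlgEquiv.spectrum_eq (Module.End.toContinuousLinearMap H).symm A]
    exact Module.End.finite_spectrum _
  rw [← spectrum.preimage_algebraMap ℂ]
  exact h.preimage (FaithfulSMul.algebraMap_injective ℝ ℂ).injOn

/-- The continuous functional calculus acts on eigenvectors through the eigenvalue. -/
theorem cfc_apply_of_eigenvector [CompleteSpace H] {A : H →L[ℂ] H} (hA : IsSelfAdjoint A)
    (f : ℝ → ℝ) {c : ℝ} {v : H} (hv : A v = (c : ℂ) • v) : cfc f A v = (f c : ℂ) • v := by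
  classical
  -- Inserting c among the nodes avoids having to show that it lies in the spectrum, and v may be
  -- zero.
  set s : Finset ℝ := insert c A.finite_spectrum_real.toFinset with hs
  have hinj : Set.InjOn (id : ℝ → ℝ) s := Function.injective_id.injOn
  set P : Polynomial ℝ := Lagrange.interpolate s id f with hP
  have heval : ∀ x ∈ s, P.eval x = f x := fun x hx =>
    Lagrange.eval_interpolate_at_node (v := id) f hinj hx
  have h1 : cfc f A = Polynomial.aeval A P := by
    rw [← cfc_polynomial P A hA]
    refine cfc_congr fun x hx => (heval x ?_).symm
    simp [hs, hx]
  have h2 : ∀ Q : Polynomial ℝ, Polynomial.aeval A Q v = ((Q.eval c : ℝ) : ℂ) • v := by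
    intro Q
    induction Q using Polynomial.induction_on' with
    | add Q R hQ hR => simp [hQ, hR, add_smul]
    | monomial n r =>
      have hn : ∀ n : ℕ, (A ^ n) v = ((c : ℂ) ^ n) • v := by
        intro n
        induction n with
        | zero => simp
        | succ n ih => rw [pow_succ, mul_apply_eq_comp, hv, map_smul, ih, smul_smul,
            pow_succ, mul_comm]
      rw [Polynomial.aeval_monomial, mul_apply_eq_comp, hn, Polynomial.eval_monomial,
        Algebra.algebraMap_eq_smul_one]
      simpa [mul_smul] using smul_comm _ _ _
  rw [h1, h2, heval c (by simp [hs])]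

omit [FiniteDimensional ℂ H] in
theorem IsPosDefOp.nonneg [CompleteSpace H] {A : H →L[ℂ] H} (hA : IsPosDefOp A) : 0 ≤ A := by
  rw [ContinuousLinearMap.nonneg_iff_isPositive, ContinuousLinearMap.isPositive_def']
  refine ⟨hA.1, fun x => ?_⟩
  rcases eq_or_ne x 0 with rfl | hx
  · simp [ContinuousLinearMap.reApplyInnerSelf]
  · exact (hA.2 x hx).le

/-- An orthonormal basis of eigenvectors of `A`, with positive eigenvalues. -/
structure PosEigenbasis (A : H →L[ℂ] H) where
  basis : OrthonormalBasis (Fin (Module.finrank ℂ H)) ℂ H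
  val : Fin (Module.finrank ℂ H) → ℝ
  pos : ∀ i, 0 < val i
  apply_basis : ∀ i, A (basis i) = (val i : ℂ) • basis i

theorem IsPosDefOp.nonempty_posEigenbasis [CompleteSpace H] {A : H →L[ℂ] H}
    (hA : IsPosDefOp A) : Nonempty (PosEigenbasis A) := by
  have hs : (A : H →ₗ[ℂ] H).IsSymmetric :=
    ContinuousLinearMap.isSelfAdjoint_iff_isSymmetric.1 hA.1
  refine ⟨⟨hs.eigenvectorBasis rfl, hs.eigenvalues rfl, fun i => ?_,
    fun i => hs.apply_eigenvectorBasis rfl i⟩⟩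
  have h := hA.2 (hs.eigenvectorBasis rfl i) ((hs.eigenvectorBasis rfl).toBasis.ne_zero i)
  have h' : A (hs.eigenvectorBasis rfl i) = _ := hs.apply_eigenvectorBasis rfl i
  rw [h', inner_smul_left] at h
  simpa using h

theorem PosEigenbasis.re_opTrace_opPower [CompleteSpace H] {A : H →L[ℂ] H} (hA : IsPosDefOp A)
    (e : PosEigenbasis A) (p : ℝ) : (opTrace (opPower A p)).re = ∑ i, e.val i ^ p := by
  rw [opTrace, LinearMap.trace_eq_sum_inner _ e.basis, Complex.re_sum]
  refine Finset.sum_congr rfl fun i _ => ?_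
  rw [ContinuousLinearMap.coe_coe, opPower, CFC.rpow_eq_cfc_real hA.nonneg,
    cfc_apply_of_eigenvector hA.1 _ (e.apply_basis i), inner_smul_right]
  simp

variable {A B : H →L[ℂ] H}

omit [FiniteDimensional ℂ H] in
theorem PosEigenbasis.inner_basis_apply [CompleteSpace H] (hB : IsSelfAdjoint B)
    (e : PosEigenbasis B) (i : Fin (Module.finrank ℂ H)) (v : H) :
    ⟪e.basis i, B v⟫_ℂ = e.val i * ⟪e.basis i, v⟫_ℂ := by
  have h := ContinuousLinearMap.isSelfAdjoint_iff_isSymmetric.1 hB (e.basis i) v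
  simp only [ContinuousLinearMap.coe_coe] at h
  rw [← h, e.apply_basis, inner_smul_left, Complex.conj_ofReal]

omit [FiniteDimensional ℂ H] in
/-- The Bregman divergence of `A ↦ Tr A ^ p` in terms of eigenvalues. -/
theorem PosEigenbasis.sum_bregman [CompleteSpace H] (hB : IsSelfAdjoint B)
    (b : PosEigenbasis B) (a : PosEigenbasis A) (p : ℝ) :
    ∑ i, ∑ j, ‖⟪b.basis i, a.basis j⟫_ℂ‖ ^ 2 *
        (b.val i ^ p - a.val j ^ p - p * a.val j ^ (p - 1) * (b.val i - a.val j))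
      = ∑ i, b.val i ^ p - ∑ j, a.val j ^ p
        - p * ∑ j, a.val j ^ (p - 1) * (⟪a.basis j, (B - A) (a.basis j)⟫_ℂ).re := by
  -- The squared overlaps of two orthonormal bases form a doubly stochastic matrix.
  have h1 : ∀ j, ∑ i, ‖⟪b.basis i, a.basis j⟫_ℂ‖ ^ 2 = 1 := fun j => by
    rw [b.basis.sum_sq_norm_inner_right]; simp
  have h2 : ∀ i, ∑ j, ‖⟪b.basis i, a.basis j⟫_ℂ‖ ^ 2 = 1 := fun i => by
    rw [a.basis.sum_sq_norm_inner_left]; simp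
  have h3 : ∀ j, (⟪a.basis j, (B - A) (a.basis j)⟫_ℂ).re
      = ∑ i, ‖⟪b.basis i, a.basis j⟫_ℂ‖ ^ 2 * (b.val i - a.val j) := by
    intro j
    have hB' : (⟪a.basis j, B (a.basis j)⟫_ℂ).re
        = ∑ i, ‖⟪b.basis i, a.basis j⟫_ℂ‖ ^ 2 * b.val i := by
      rw [← b.basis.sum_inner_mul_inner, Complex.re_sum]
      refine Finset.sum_congr rfl fun i _ => ?_
      rw [b.inner_basis_apply hB, ← inner_conj_symm (a.basis j), mul_left_comm,
        Complex.conj_mul']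
      norm_cast
      ring
    have hA' : (⟪a.basis j, A (a.basis j)⟫_ℂ).re = a.val j := by
      rw [a.apply_basis, inner_smul_right]; simp
    simp only [mul_sub, Finset.sum_sub_distrib, ← Finset.sum_mul, h1, one_mul]
    simp [hB', hA']
  have e1 : ∑ i, b.val i ^ p = ∑ i, ∑ j, ‖⟪b.basis i, a.basis j⟫_ℂ‖ ^ 2 * b.val i ^ p := by
    simp [← Finset.sum_mul, h2]
  have e2 : ∑ j, a.val j ^ p = ∑ i, ∑ j, ‖⟪b.basis i, a.basis j⟫_ℂ‖ ^ 2 * a.val j ^ p := by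
    rw [Finset.sum_comm]; simp [← Finset.sum_mul, h1]
  have e3 : p * ∑ j, a.val j ^ (p - 1) * (⟪a.basis j, (B - A) (a.basis j)⟫_ℂ).re
      = ∑ i, ∑ j, ‖⟪b.basis i, a.basis j⟫_ℂ‖ ^ 2 *
        (p * a.val j ^ (p - 1) * (b.val i - a.val j)) := by
    rw [Finset.sum_comm, Finset.mul_sum]
    refine Finset.sum_congr rfl fun j _ => ?_
    rw [h3, Finset.mul_sum, Finset.mul_sum]
    exact Finset.sum_congr rfl fun i _ => by ring
  rw [e1, e2, e3, ← Finset.sum_sub_distrib, ← Finset.sum_sub_distrib]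
  refine Finset.sum_congr rfl fun i _ => ?_
  rw [← Finset.sum_sub_distrib, ← Finset.sum_sub_distrib]
  exact Finset.sum_congr rfl fun j _ => by ring

end Spectral

/-! ### Variational formula for the resolvent form -/

section Variational

variable {H : Type*} [NormedAddCommGroup H] [InnerProductSpace ℂ H] [FiniteDimensional ℂ H]

/-- The concave functional of `Z` whose maximum is the quadratic form of the resolvent of
`α B · + β · A` at `B - A`. -/
def resolventForm (Z B A : H →ₗ[ℂ] H) (t α β : ℝ) : ℝ :=
  2 * (LinearMap.trace ℂ H (Z.adjoint * (B - A))).re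
    - t * (LinearMap.trace ℂ H (Z.adjoint * Z)).re
    - α * (LinearMap.trace ℂ H (Z.adjoint * (B * Z))).re
    - β * (LinearMap.trace ℂ H (Z.adjoint * (Z * A))).re

theorem trace_adjoint_mul_eq_sum {ι κ : Type*} [Fintype ι] [Fintype κ]
    (b : OrthonormalBasis ι ℂ H) (a : OrthonormalBasis κ ℂ H) (Z T : H →ₗ[ℂ] H) :
    LinearMap.trace ℂ H (Z.adjoint * T)
      = ∑ i, ∑ j, (starRingEnd ℂ) ⟪b i, Z (a j)⟫_ℂ * ⟪b i, T (a j)⟫_ℂ := by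
  rw [LinearMap.trace_eq_sum_inner _ a, Finset.sum_comm]
  refine Finset.sum_congr rfl fun j _ => ?_
  rw [Module.End.mul_apply, LinearMap.adjoint_inner_right, ← b.sum_inner_mul_inner]
  exact Finset.sum_congr rfl fun i _ => by rw [inner_conj_symm]

variable {A B : H →L[ℂ] H}

/-- The rank-one operators |b_i⟩⟨a_j| diagonalise L_B and R_A simultaneously, so the functional
decouples into one scalar problem per coefficient of Z. -/
theorem resolventForm_eq_sum [CompleteSpace H] (hB : IsSelfAdjoint B) (b : PosEigenbasis B)
    (a : PosEigenbasis A) (Z : H →ₗ[ℂ] H) (t α β : ℝ) :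
    resolventForm Z B A t α β = ∑ i, ∑ j,
      (2 * ((starRingEnd ℂ) ⟪b.basis i, Z (a.basis j)⟫_ℂ *
          ((b.val i - a.val j : ℝ) * ⟪b.basis i, a.basis j⟫_ℂ)).re
        - (t + (α * b.val i + β * a.val j)) * ‖⟪b.basis i, Z (a.basis j)⟫_ℂ‖ ^ 2) := by
  have hn : ∀ z : ℂ, ((starRingEnd ℂ) z * z).re = ‖z‖ ^ 2 := fun z => by
    rw [Complex.conj_mul']; norm_cast
  have hn' : ∀ (z : ℂ) (r : ℝ), ((starRingEnd ℂ) z * (r * z)).re = r * ‖z‖ ^ 2 := fun z r => by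
    rw [mul_left_comm, Complex.re_ofReal_mul, hn]
  simp only [resolventForm, trace_adjoint_mul_eq_sum b.basis a.basis, Complex.re_sum,
    Finset.mul_sum, ← Finset.sum_sub_distrib]
  refine Finset.sum_congr rfl fun i _ => Finset.sum_congr rfl fun j _ => ?_
  have h1 : ⟪b.basis i, ((B : H →ₗ[ℂ] H) - A) (a.basis j)⟫_ℂ
      = (b.val i - a.val j : ℝ) * ⟪b.basis i, a.basis j⟫_ℂ := by
    rw [LinearMap.sub_apply, ContinuousLinearMap.coe_coe, ContinuousLinearMap.coe_coe,
      inner_sub_right, b.inner_basis_apply hB, a.apply_basis, inner_smul_right]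
    push_cast
    ring
  have h2 : ⟪b.basis i, ((B : H →ₗ[ℂ] H) * Z) (a.basis j)⟫_ℂ
      = (b.val i : ℝ) * ⟪b.basis i, Z (a.basis j)⟫_ℂ := by
    rw [Module.End.mul_apply, ContinuousLinearMap.coe_coe, b.inner_basis_apply hB]
  have h3 : ⟪b.basis i, (Z * (A : H →ₗ[ℂ] H)) (a.basis j)⟫_ℂ
      = (a.val j : ℝ) * ⟪b.basis i, Z (a.basis j)⟫_ℂ := by
    rw [Module.End.mul_apply, ContinuousLinearMap.coe_coe, a.apply_basis, map_smul,
      inner_smul_right]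
  rw [h1, h2, h3, hn, hn', hn']
  ring

/-- Completing the square; the maximum is at z = h / u. -/
theorem Complex.two_mul_re_conj_mul_sub_le (z h : ℂ) {u : ℝ} (hu : 0 < u) :
    2 * ((starRingEnd ℂ) z * h).re - u * ‖z‖ ^ 2 ≤ ‖h‖ ^ 2 * u⁻¹ := by
  have h1 : ((starRingEnd ℂ) z * h).re ≤ ‖z‖ * ‖h‖ := by
    simpa using Complex.re_le_norm ((starRingEnd ℂ) z * h)
  rw [← div_eq_mul_inv, le_div_iff₀ hu]
  nlinarith [sq_nonneg (u * ‖z‖ - ‖h‖), mul_le_mul_of_nonneg_left h1 hu.le]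

theorem resolventForm_le [CompleteSpace H] (hB : IsSelfAdjoint B) (b : PosEigenbasis B)
    (a : PosEigenbasis A) (Z : H →ₗ[ℂ] H) {t α β : ℝ}
    (hu : ∀ i j, 0 < t + (α * b.val i + β * a.val j)) :
    resolventForm Z B A t α β ≤ ∑ i, ∑ j,
      ((b.val i - a.val j) ^ 2 * ‖⟪b.basis i, a.basis j⟫_ℂ‖ ^ 2) *
        (t + (α * b.val i + β * a.val j))⁻¹ := by
  rw [resolventForm_eq_sum hB b a]
  refine Finset.sum_le_sum fun i _ => Finset.sum_le_sum fun j _ => ?_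
  refine (Complex.two_mul_re_conj_mul_sub_le _ _ (hu i j)).trans_eq ?_
  rw [norm_mul, mul_pow, Complex.norm_real, Real.norm_eq_abs, sq_abs]

theorem exists_resolventForm_eq [CompleteSpace H] (hB : IsSelfAdjoint B) (b : PosEigenbasis B)
    (a : PosEigenbasis A) {t α β : ℝ} (hu : ∀ i j, 0 < t + (α * b.val i + β * a.val j)) :
    ∃ Z : H →ₗ[ℂ] H, resolventForm Z B A t α β = ∑ i, ∑ j,
      ((b.val i - a.val j) ^ 2 * ‖⟪b.basis i, a.basis j⟫_ℂ‖ ^ 2) *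
        (t + (α * b.val i + β * a.val j))⁻¹ := by
  -- The coefficients h / u of the maximiser, with h = ⟨b_i, (B - A) a_j⟩.
  set c : Fin (Module.finrank ℂ H) → Fin (Module.finrank ℂ H) → ℂ := fun i j =>
    ((t + (α * b.val i + β * a.val j))⁻¹ : ℝ) *
      ((b.val i - a.val j : ℝ) * ⟪b.basis i, a.basis j⟫_ℂ) with hc
  refine ⟨a.basis.toBasis.constr ℂ fun j => ∑ i, c i j • b.basis i, ?_⟩
  rw [resolventForm_eq_sum hB b a]
  refine Finset.sum_congr rfl fun i _ => Finset.sum_congr rfl fun j _ => ?_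
  have hz : ⟪b.basis i, a.basis.toBasis.constr ℂ (fun j => ∑ i, c i j • b.basis i)
      (a.basis j)⟫_ℂ = c i j := by
    rw [← a.basis.coe_toBasis, Module.Basis.constr_basis, b.basis.orthonormal.inner_right_fintype]
  have hu' := (hu i j).ne'
  set u := t + (α * b.val i + β * a.val j) with hu_def
  set h : ℂ := (b.val i - a.val j : ℝ) * ⟪b.basis i, a.basis j⟫_ℂ with hh
  have hnorm : ‖h‖ ^ 2 = (b.val i - a.val j) ^ 2 * ‖⟪b.basis i, a.basis j⟫_ℂ‖ ^ 2 := by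
    rw [hh, norm_mul, mul_pow, Complex.norm_real, Real.norm_eq_abs, sq_abs]
  have hre : ((starRingEnd ℂ) ((u⁻¹ : ℝ) * h) * h).re = u⁻¹ * ‖h‖ ^ 2 := by
    rw [map_mul, Complex.conj_ofReal, mul_assoc, Complex.re_ofReal_mul, Complex.conj_mul']
    norm_cast
  have hsq : ‖(u⁻¹ : ℝ) * h‖ ^ 2 = u⁻¹ ^ 2 * ‖h‖ ^ 2 := by
    rw [norm_mul, mul_pow, Complex.norm_real, Real.norm_eq_abs, sq_abs]
  rw [hz, show c i j = (u⁻¹ : ℝ) * h from rfl, hre, hsq, ← hnorm]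
  field_simp
  ring

end Variational

/-! ### Partial trace and monotonicity -/

section PartialTrace

variable {H₁ H₂ : Type*}
  [NormedAddCommGroup H₁] [InnerProductSpace ℂ H₁] [FiniteDimensional ℂ H₁]
  [NormedAddCommGroup H₂] [InnerProductSpace ℂ H₂] [FiniteDimensional ℂ H₂]

theorem partialTrace₂_add (ρ σ : (H₁ ⊗[ℂ] H₂) →L[ℂ] (H₁ ⊗[ℂ] H₂)) :
    partialTrace₂ (ρ + σ) = partialTrace₂ ρ + partialTrace₂ σ := by
  simp [partialTrace₂]

theorem partialTrace₂_sub (ρ σ : (H₁ ⊗[ℂ] H₂) →L[ℂ] (H₁ ⊗[ℂ] H₂)) :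
    partialTrace₂ (ρ - σ) = partialTrace₂ ρ - partialTrace₂ σ := by
  simp [partialTrace₂]

theorem partialTrace₂_smul (r : ℝ) (ρ : (H₁ ⊗[ℂ] H₂) →L[ℂ] (H₁ ⊗[ℂ] H₂)) :
    partialTrace₂ (r • ρ) = r • partialTrace₂ ρ := by
  have h : ∀ (c : ℂ) (ρ : (H₁ ⊗[ℂ] H₂) →L[ℂ] (H₁ ⊗[ℂ] H₂)),
      partialTrace₂ (c • ρ) = c • partialTrace₂ ρ := fun c ρ => by simp [partialTrace₂]
  rw [← Complex.coe_smul, ← Complex.coe_smul]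
  exact h r ρ

/-- Induction on tensors of operators for statements about the partial trace. -/
theorem partialTrace₂_induction
    {P : ((H₁ ⊗[ℂ] H₂) →ₗ[ℂ] (H₁ ⊗[ℂ] H₂)) → (H₁ →ₗ[ℂ] H₁) → Prop} (zero : P 0 0)
    (map : ∀ X Y, P (TensorProduct.map X Y) (LinearMap.trace ℂ H₂ Y • X))
    (add : ∀ ρ σ X Y, P ρ X → P σ Y → P (ρ + σ) (X + Y))
    (ρ : (H₁ ⊗[ℂ] H₂) →L[ℂ] (H₁ ⊗[ℂ] H₂)) : P ρ (partialTrace₂ ρ) := by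
  have h : ∀ x : (H₁ →ₗ[ℂ] H₁) ⊗[ℂ] (H₂ →ₗ[ℂ] H₂),
      P (homTensorHomEquiv ℂ H₁ H₂ H₁ H₂ x) (TensorProduct.rid ℂ (H₁ →ₗ[ℂ] H₁)
        (TensorProduct.map LinearMap.id (LinearMap.trace ℂ H₂) x)) := by
    intro x
    induction x with
    | zero => simpa using zero
    | tmul X Y => simpa using map X Y
    | add x y hx hy => simpa only [map_add] using add _ _ _ _ hx hy
  have := h ((homTensorHomEquiv ℂ H₁ H₂ H₁ H₂).symm ρ)
  rwa [LinearEquiv.apply_symm_apply] at this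

/-- The partial trace is dual to X ↦ X ⊗ 1 under the trace pairing. -/
theorem trace_rTensor_mul (X : H₁ →ₗ[ℂ] H₁) (ρ : (H₁ ⊗[ℂ] H₂) →L[ℂ] (H₁ ⊗[ℂ] H₂)) :
    LinearMap.trace ℂ (H₁ ⊗[ℂ] H₂) (X.rTensor H₂ * ρ)
      = LinearMap.trace ℂ H₁ (X * partialTrace₂ ρ) := by
  refine partialTrace₂_induction (P := fun ρ R =>
    LinearMap.trace ℂ (H₁ ⊗[ℂ] H₂) (X.rTensor H₂ * ρ) = LinearMap.trace ℂ H₁ (X * R))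
    (by simp) (fun Y W => ?_) (fun ρ σ Y W h h' => by rw [mul_add, mul_add, map_add, map_add, h, h'])
    ρ
  rw [LinearMap.rTensor, Module.End.mul_eq_comp, ← TensorProduct.map_comp, LinearMap.id_comp,
    LinearMap.trace_tensorProduct', mul_smul_comm, map_smul, smul_eq_mul, mul_comm,
    Module.End.mul_eq_comp]

theorem inner_partialTrace₂_apply {ι : Type*} [Fintype ι] (e : OrthonormalBasis ι ℂ H₂)
    (ρ : (H₁ ⊗[ℂ] H₂) →L[ℂ] (H₁ ⊗[ℂ] H₂)) (x y : H₁) :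
    ⟪x, partialTrace₂ ρ y⟫_ℂ = ∑ k, ⟪x ⊗ₜ[ℂ] e k, ρ (y ⊗ₜ[ℂ] e k)⟫_ℂ := by
  refine partialTrace₂_induction (P := fun ρ R =>
    ⟪x, R y⟫_ℂ = ∑ k, ⟪x ⊗ₜ[ℂ] e k, ρ (y ⊗ₜ[ℂ] e k)⟫_ℂ)
    (by simp) (fun Y W => ?_) (fun ρ σ Y W h h' => ?_) ρ
  · simp only [TensorProduct.map_tmul, TensorProduct.inner_tmul, ← Finset.mul_sum,
      ← LinearMap.trace_eq_sum_inner, LinearMap.smul_apply, inner_smul_right]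
    rw [mul_comm]
  · simp only [LinearMap.add_apply, inner_add_right, Finset.sum_add_distrib, h, h']

theorem IsPosDefOp.partialTrace₂ [CompleteSpace H₁] [Nontrivial H₂]
    {ρ : (H₁ ⊗[ℂ] H₂) →L[ℂ] (H₁ ⊗[ℂ] H₂)} (hρ : IsPosDefOp ρ) :
    IsPosDefOp (partialTrace₂ ρ) := by
  set e := stdOrthonormalBasis ℂ H₂
  have hsymm := ContinuousLinearMap.isSelfAdjoint_iff_isSymmetric.1 hρ.1
  have hleft : ∀ x y : H₁, ⟪_root_.partialTrace₂ ρ x, y⟫_ℂ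
      = ∑ k, ⟪ρ (x ⊗ₜ[ℂ] e k), y ⊗ₜ[ℂ] e k⟫_ℂ := fun x y => by
    rw [← inner_conj_symm, inner_partialTrace₂_apply e, map_sum]
    exact Finset.sum_congr rfl fun k _ =>
      inner_conj_symm (ρ (x ⊗ₜ[ℂ] e k)) (y ⊗ₜ[ℂ] e k)
  constructor
  · rw [ContinuousLinearMap.isSelfAdjoint_iff_isSymmetric]
    intro x y
    simp only [ContinuousLinearMap.coe_coe]
    rw [hleft, inner_partialTrace₂_apply e]
    exact Finset.sum_congr rfl fun k _ => hsymm _ _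
  · intro x hx
    rw [hleft, Complex.re_sum]
    have : Nonempty (Fin (Module.finrank ℂ H₂)) := ⟨⟨0, Module.finrank_pos⟩⟩
    refine Finset.sum_pos (fun k _ => hρ.2 _ ?_) Finset.univ_nonempty
    rw [← norm_ne_zero_iff, TensorProduct.norm_tmul, e.norm_eq_one, mul_one]
    exact norm_ne_zero_iff.2 hx

/-- The terms linear in A or B reduce by trace duality, using cyclicity for B; only Tr(Z* Z)
acquires the factor Tr 1 = d. -/
theorem resolventForm_rTensor (Z : H₁ →ₗ[ℂ] H₁) (B A : (H₁ ⊗[ℂ] H₂) →L[ℂ] (H₁ ⊗[ℂ] H₂))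
    (t α β : ℝ) :
    resolventForm (Z.rTensor H₂) B A t α β
      = resolventForm Z (partialTrace₂ B) (partialTrace₂ A) (Module.finrank ℂ H₂ * t) α β := by
  have h1 : LinearMap.trace ℂ _ ((Z.rTensor H₂).adjoint *
        ((B : (H₁ ⊗[ℂ] H₂) →ₗ[ℂ] (H₁ ⊗[ℂ] H₂)) - (A : (H₁ ⊗[ℂ] H₂) →ₗ[ℂ] (H₁ ⊗[ℂ] H₂))))
      = LinearMap.trace ℂ _ (Z.adjoint *
        ((partialTrace₂ B : H₁ →ₗ[ℂ] H₁) - (partialTrace₂ A : H₁ →ₗ[ℂ] H₁))) := by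
    rw [LinearMap.adjoint_rTensor, mul_sub, mul_sub, map_sub, map_sub, trace_rTensor_mul,
      trace_rTensor_mul]
  have h2 : LinearMap.trace ℂ _ ((Z.rTensor H₂).adjoint * Z.rTensor H₂)
      = Module.finrank ℂ H₂ * LinearMap.trace ℂ _ (Z.adjoint * Z) := by
    rw [LinearMap.adjoint_rTensor, ← LinearMap.rTensor_mul, LinearMap.rTensor,
      LinearMap.trace_tensorProduct', LinearMap.trace_id, mul_comm]
  have h3 : LinearMap.trace ℂ _ ((Z.rTensor H₂).adjoint *
        ((B : (H₁ ⊗[ℂ] H₂) →ₗ[ℂ] (H₁ ⊗[ℂ] H₂)) * Z.rTensor H₂))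
      = LinearMap.trace ℂ _ (Z.adjoint * ((partialTrace₂ B : H₁ →ₗ[ℂ] H₁) * Z)) := by
    rw [← mul_assoc, LinearMap.trace_mul_comm, ← mul_assoc, LinearMap.adjoint_rTensor,
      ← LinearMap.rTensor_mul, trace_rTensor_mul, mul_assoc, LinearMap.trace_mul_comm, mul_assoc]
  have h4 : LinearMap.trace ℂ _ ((Z.rTensor H₂).adjoint *
        (Z.rTensor H₂ * (A : (H₁ ⊗[ℂ] H₂) →ₗ[ℂ] (H₁ ⊗[ℂ] H₂))))
      = LinearMap.trace ℂ _ (Z.adjoint * (Z * (partialTrace₂ A : H₁ →ₗ[ℂ] H₁))) := by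
    rw [← mul_assoc, LinearMap.adjoint_rTensor, ← LinearMap.rTensor_mul, trace_rTensor_mul,
      mul_assoc]
  rw [resolventForm, resolventForm, h1, h2, h3, h4, ← Complex.ofReal_natCast, Complex.re_ofReal_mul]
  ring

/-- The quadratic form of the resolvent decreases under the partial trace. -/
theorem sum_inv_partialTrace₂_le [CompleteSpace H₁] [Nontrivial H₂]
    {B A : (H₁ ⊗[ℂ] H₂) →L[ℂ] (H₁ ⊗[ℂ] H₂)}
    (hB : IsPosDefOp B) (b : PosEigenbasis B) (a : PosEigenbasis A)
    (b' : PosEigenbasis (partialTrace₂ B)) (a' : PosEigenbasis (partialTrace₂ A)) {t α β : ℝ}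
    (hu : ∀ x y : ℝ, 0 < x → 0 < y → ∀ r, t ≤ r ∨ r = Module.finrank ℂ H₂ * t →
      0 < r + (α * x + β * y)) :
    ∑ i, ∑ j, ((b'.val i - a'.val j) ^ 2 * ‖⟪b'.basis i, a'.basis j⟫_ℂ‖ ^ 2) *
        (Module.finrank ℂ H₂ * t + (α * b'.val i + β * a'.val j))⁻¹
      ≤ ∑ i, ∑ j, ((b.val i - a.val j) ^ 2 * ‖⟪b.basis i, a.basis j⟫_ℂ‖ ^ 2) *
        (t + (α * b.val i + β * a.val j))⁻¹ := by
  -- The maximiser Z for the partial traces, tensored with 1, is a competitor upstairs.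
  obtain ⟨Z, hZ⟩ := exists_resolventForm_eq hB.partialTrace₂.1 b' a'
    (t := Module.finrank ℂ H₂ * t) (α := α) (β := β)
    fun i j => hu _ _ (b'.pos i) (a'.pos j) _ (Or.inr rfl)
  rw [← hZ, ← resolventForm_rTensor]
  exact resolventForm_le hB.1 b a _ fun i j => hu _ _ (b.pos i) (a.pos j) _ (Or.inl le_rfl)

/-- The Bregman divergence of `A ↦ Tr A ^ p` under the partial trace. -/
theorem sum_bregman_partialTrace₂_le [CompleteSpace H₁] [Nontrivial H₂] {p : ℝ} (hp₁ : 1 ≤ p)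
    (hp₂ : p ≤ 2) {B A : (H₁ ⊗[ℂ] H₂) →L[ℂ] (H₁ ⊗[ℂ] H₂)}
    (hB : IsPosDefOp B) (b : PosEigenbasis B) (a : PosEigenbasis A)
    (b' : PosEigenbasis (partialTrace₂ B)) (a' : PosEigenbasis (partialTrace₂ A)) :
    ∑ i, ∑ j, ‖⟪b'.basis i, a'.basis j⟫_ℂ‖ ^ 2 *
        (b'.val i ^ p - a'.val j ^ p - p * a'.val j ^ (p - 1) * (b'.val i - a'.val j))
      ≤ (Module.finrank ℂ H₂ : ℝ) ^ (p - 1) * ∑ i, ∑ j, ‖⟪b.basis i, a.basis j⟫_ℂ‖ ^ 2 *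
        (b.val i ^ p - a.val j ^ p - p * a.val j ^ (p - 1) * (b.val i - a.val j)) := by
  have hd : (0 : ℝ) < Module.finrank ℂ H₂ := by exact_mod_cast Module.finrank_pos
  obtain ⟨hI, hS⟩ := sum_bregman_rpow p (m := fun i j => ‖⟪b.basis i, a.basis j⟫_ℂ‖ ^ 2)
    b.pos a.pos
  obtain ⟨hI', hS'⟩ := sum_bregman_rpow p (m := fun i j => ‖⟪b'.basis i, a'.basis j⟫_ℂ‖ ^ 2)
    b'.pos a'.pos
  rw [← hS, ← hS', ← intervalIntegral.integral_const_mul]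
  refine intervalIntegral.integral_mono_on zero_le_one hI' (hI.const_mul _) fun s hs => ?_
  have key := sum_rpow_le_of_sum_inv_le hp₁ hp₂ hd
    (w := fun k : _ × _ => (b.val k.1 - a.val k.2) ^ 2 * ‖⟪b.basis k.1, a.basis k.2⟫_ℂ‖ ^ 2)
    (u := fun k => s * b.val k.1 + (1 - s) * a.val k.2)
    (w' := fun k : _ × _ =>
      (b'.val k.1 - a'.val k.2) ^ 2 * ‖⟪b'.basis k.1, a'.basis k.2⟫_ℂ‖ ^ 2)
    (u' := fun k => s * b'.val k.1 + (1 - s) * a'.val k.2)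
    (fun k => add_mul_one_sub_pos (b.pos _) (a.pos _) hs)
    (fun k => add_mul_one_sub_pos (b'.pos _) (a'.pos _) hs)
    (fun t ht => ?_) ?_
  · simp only [Fintype.sum_prod_type] at key
    -- The Taylor weight is nonnegative because p ≥ 1 and s ≤ 1.
    have hc : 0 ≤ p * (p - 1) * (1 - s) :=
      mul_nonneg (mul_nonneg (by linarith) (by linarith)) (sub_nonneg.2 hs.2)
    have := mul_le_mul_of_nonneg_left key hc
    rw [mul_left_comm] at this
    simp only [Finset.mul_sum] at this ⊢
    refine le_of_eq_of_le ?_ (this.trans_eq ?_)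
    · exact Finset.sum_congr rfl fun i _ => Finset.sum_congr rfl fun j _ => by ring
    · exact Finset.sum_congr rfl fun i _ => Finset.sum_congr rfl fun j _ => by ring
  · simp only [Fintype.sum_prod_type]
    refine sum_inv_partialTrace₂_le hB b a b' a' fun x y hx hy r hr => ?_
    have h0 : 0 ≤ r := by
      rcases hr with hr | rfl
      · exact ht.trans hr
      · exact mul_nonneg hd.le ht
    exact add_pos_of_nonneg_of_pos h0 (add_mul_one_sub_pos hx hy hs)
  · simp only [Fintype.sum_prod_type]
    -- With α = β = 0 the resolvents are the constants 1/d and 1, which gives the bound needed for p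
    -- = 2.
    have := sum_inv_partialTrace₂_le hB b a b' a' (t := 1) (α := 0) (β := 0)
      fun x y hx hy r hr => by
        rcases hr with hr | rfl
        · linarith
        · linarith
    simp only [zero_mul, add_zero, mul_one, inv_one, ← Finset.sum_mul] at this
    rwa [← div_eq_mul_inv, div_le_iff₀' hd] at this

/-! ### Supporting functionals and convexity -/

/-- The diagonal functional `X ↦ ∑ c j * Re ⟪v j, X (v j)⟫`. -/
def diagForm {H ι : Type*} [NormedAddCommGroup H] [InnerProductSpace ℂ H] [Fintype ι]
    (v : ι → H) (c : ι → ℝ) : (H →L[ℂ] H) →ₗ[ℝ] ℝ where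
  toFun X := ∑ j, c j * (⟪v j, X (v j)⟫_ℂ).re
  map_add' X Y := by simp [mul_add, Finset.sum_add_distrib]
  map_smul' r X := by
    simp only [smul_apply, RingHom.id_apply, smul_eq_mul, Finset.mul_sum]
    refine Finset.sum_congr rfl fun j _ => ?_
    rw [← Complex.coe_smul, inner_smul_right, Complex.re_ofReal_mul]
    ring

/-- A function with a supporting affine function at every point of a convex set is convex. -/
theorem ConvexOn.of_exists_support {E : Type*} [AddCommMonoid E] [SMul ℝ E] {S : Set E}
    (hS : Convex ℝ S) {f : E → ℝ}
    (h : ∀ x ∈ S, ∃ l : E → ℝ, (∀ (a b : ℝ) (y z : E), l (a • y + b • z) = a * l y + b * l z) ∧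
      ∀ y ∈ S, f x + (l y - l x) ≤ f y) : ConvexOn ℝ S f := by
  refine ⟨hS, fun x hx y hy a b ha hb hab => ?_⟩
  obtain ⟨l, hlin, hl⟩ := h _ (hS hx hy ha hb hab)
  have h1 := mul_le_mul_of_nonneg_left (hl x hx) ha
  have h2 := mul_le_mul_of_nonneg_left (hl y hy) hb
  rw [hlin] at h1 h2
  obtain rfl : b = 1 - a := by linarith
  simp only [smul_eq_mul]
  linarith

theorem convex_isPosDefOp {H : Type*} [NormedAddCommGroup H] [InnerProductSpace ℂ H]
    [CompleteSpace H] : Convex ℝ {A : H →L[ℂ] H | IsPosDefOp A} := by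
  intro A hA B hB a b ha hb hab
  refine ⟨((IsSelfAdjoint.all a).smul hA.1).add ((IsSelfAdjoint.all b).smul hB.1),
    fun x hx => ?_⟩
  have h : (⟪(a • A + b • B) x, x⟫_ℂ).re = a * (⟪A x, x⟫_ℂ).re + b * (⟪B x, x⟫_ℂ).re := by
    rw [add_apply, smul_apply,
      smul_apply, ← Complex.coe_smul, ← Complex.coe_smul, inner_add_left,
      inner_smul_left, inner_smul_left, Complex.conj_ofReal, Complex.conj_ofReal, Complex.add_re,
      Complex.re_ofReal_mul, Complex.re_ofReal_mul]
  rw [h]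
  obtain rfl : b = 1 - a := by linarith
  exact add_mul_one_sub_pos (hA.2 x hx) (hB.2 x hx) ⟨ha, by linarith⟩

/-- The partial trace as a real-linear map. -/
def partialTrace₂RealLinear : ((H₁ ⊗[ℂ] H₂) →L[ℂ] (H₁ ⊗[ℂ] H₂)) →ₗ[ℝ] (H₁ →L[ℂ] H₁) where
  toFun := partialTrace₂
  map_add' := partialTrace₂_add
  map_smul' := partialTrace₂_smul

theorem exists_support_trace_rpow_sub [CompleteSpace H₁] {p : ℝ} (hp₁ : 1 ≤ p)
    (hp₂ : p ≤ 2) {A : (H₁ ⊗[ℂ] H₂) →L[ℂ] (H₁ ⊗[ℂ] H₂)} (hA : IsPosDefOp A) :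
    ∃ l : ((H₁ ⊗[ℂ] H₂) →L[ℂ] (H₁ ⊗[ℂ] H₂)) →ₗ[ℝ] ℝ, ∀ B, IsPosDefOp B →
      (Module.finrank ℂ H₂ : ℝ) ^ (p - 1) * (opTrace (opPower A p)).re
          - (opTrace (opPower (partialTrace₂ A) p)).re + l (B - A)
        ≤ (Module.finrank ℂ H₂ : ℝ) ^ (p - 1) * (opTrace (opPower B p)).re
          - (opTrace (opPower (partialTrace₂ B) p)).re := by
  rcases subsingleton_or_nontrivial H₂ with hH | hH
  · have hT : Subsingleton (H₁ ⊗[ℂ] H₂) := by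
      refine subsingleton_of_forall_eq 0 fun x => ?_
      induction x with
      | zero => rfl
      | tmul x y => rw [Subsingleton.elim y 0, TensorProduct.tmul_zero]
      | add x y hx hy => rw [hx, hy, add_zero]
    refine ⟨0, fun B hB => ?_⟩
    have : B = A := ContinuousLinearMap.ext fun x => Subsingleton.elim _ _
    rw [this, sub_self, map_zero, add_zero]
  obtain ⟨a⟩ := hA.nonempty_posEigenbasis
  obtain ⟨a'⟩ := hA.partialTrace₂.nonempty_posEigenbasis
  -- The derivative of G at A: X ↦ d^(p-1) p Tr(A^(p-1) X) - p Tr(A₁^(p-1) X₁), written in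
  -- eigenbases.
  refine ⟨((Module.finrank ℂ H₂ : ℝ) ^ (p - 1) * p) •
      diagForm a.basis (fun j => a.val j ^ (p - 1))
    - p • (diagForm a'.basis fun j => a'.val j ^ (p - 1)).comp partialTrace₂RealLinear,
    fun B hB => ?_⟩
  obtain ⟨b⟩ := hB.nonempty_posEigenbasis
  obtain ⟨b'⟩ := hB.partialTrace₂.nonempty_posEigenbasis
  have key := sum_bregman_partialTrace₂_le hp₁ hp₂ hB b a b' a'
  rw [b.sum_bregman hB.1 a p, b'.sum_bregman hB.partialTrace₂.1 a' p,
    ← partialTrace₂_sub] at key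
  simp only [b.re_opTrace_opPower hB, a.re_opTrace_opPower hA,
    b'.re_opTrace_opPower hB.partialTrace₂, a'.re_opTrace_opPower hA.partialTrace₂,
    LinearMap.sub_apply, LinearMap.smul_apply, LinearMap.comp_apply, smul_eq_mul]
  have e1 : diagForm a.basis (fun j => a.val j ^ (p - 1)) (B - A)
      = ∑ j, a.val j ^ (p - 1) * (⟪a.basis j, (B - A) (a.basis j)⟫_ℂ).re := rfl
  have e2 : diagForm a'.basis (fun j => a'.val j ^ (p - 1)) (partialTrace₂RealLinear (B - A))
      = ∑ j, a'.val j ^ (p - 1) * (⟪a'.basis j, partialTrace₂ (B - A) (a'.basis j)⟫_ℂ).re := rfl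
  rw [e1, e2]
  linarith

end PartialTrace

end

theorem mainTheorem4 {H₁ H₂ : Type*}
    [NormedAddCommGroup H₁] [InnerProductSpace ℂ H₁] [CompleteSpace H₁] [FiniteDimensional ℂ H₁]
    [NormedAddCommGroup H₂] [InnerProductSpace ℂ H₂] [CompleteSpace H₂] [FiniteDimensional ℂ H₂]
    (p : ℝ) (hp₁ : 1 ≤ p) (hp₂ : p ≤ 2) :
    ConvexOn ℝ {ρ : (H₁ ⊗[ℂ] H₂) →L[ℂ] (H₁ ⊗[ℂ] H₂) | IsPosDefOp ρ}
      (fun ρ => (Module.finrank ℂ H₂ : ℝ) ^ (p - 1) * (opTrace (opPower ρ p)).re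
        - (opTrace (opPower (partialTrace₂ ρ) p)).re) := by
  refine ConvexOn.of_exists_support (convex_isPosDefOp (H := H₁ ⊗[ℂ] H₂)) fun A hA => ?_
  obtain ⟨l, hl⟩ := exists_support_trace_rpow_sub hp₁ hp₂ hA
  refine ⟨l, fun a b y z => ?_, fun B hB => ?_⟩
  · rw [map_add, map_smul, map_smul, smul_eq_mul, smul_eq_mul]
  · rw [← map_sub]
    exact hl B hB
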